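/- Let $(\Omega,\mathcal A)$ be a measurable space and let $U\subset\mathbb C^n$ be a connected Reinhardt domain, i.e. a nonempty connected open set such that $(e^{i\theta_1}z_1,\ldots,e^{i\theta_n}z_n)\in U$ whenever $(z_1,\ldots,z_n)\in U$ and $\theta_1,\ldots,\theta_n\in\mathbb R$. Let $f:\Omega\times U\to\mathbb C$ be a random holomorphic function on $U$, i.e. $f(\cdot,z)$ is measurable for every $z\in U$ and $f(\omega,\cdot)$ is holomorphic on $U$ for every $\omega\in\Omega$. Write $z^\alpha=z_1^{\alpha_1}\cdots z_n^{\alpha_n}$ for $\alpha\in\mathbb Z^n$. A Laurent series $\sum_{\alpha\in\mathbb Z^n}a_\alpha z^\alpha$ on $U$ is understood to have all its terms defined on $U$: $a_\alpha=0$ whenever $\alpha_j<0$ for some $j$ such that $U$ contains a point with $z_j=0$. It is an expansion of a function $g:U\to\mathbb C$ if for every $z\in U$ it converges absolutely with sum $g(z)$. It converges normally on $U$ if for every compact $K\subset U$ and every $\varepsilon>0$ there is a finite set $\Lambda\subset\mathbb Z^n$ with $\sum_{\alpha\notin\Lambda}|a_\alpha z^\alpha|<\varepsilon$ for all $z\in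 K$. (1) There are measurable functions $a_\alpha:\Omega\to\mathbb C$, $\alpha\in\mathbb Z^n$, such that for every $\omega\in\Omega$ the Laurent series $\sum_{\alpha\in\mathbb Z^n}a_\alpha(\omega)z^\alpha$ is an expansion of $f(\omega,\cdot)$ on $U$ and converges normally on $U$ to $f(\omega,\cdot)$. This expansion is unique: for every $\omega$, every Laurent series on $U$ that is an expansion of $f(\omega,\cdot)$ has the coefficients $a_\alpha(\omega)$. (2) There is a sequence $r_1,r_2,\ldots$ of random rational functions without poles on $U$ such that for every $\omega\in\Omega$ the sequence $r_k(\omega,\cdot)$ converges to $f(\omega,\cdot)$ uniformly on every compact subset of $U$. Here a random rational function without poles on $U$ is a quotient $p(\omega,z)/q(\omega,z)$, where $p(\omega,\cdot)$ and $q(\omega,\cdot)$ are polynomials for every $\omega$, $p(\cdot,z)$ and $q(\cdot,z)$ are measurable for every $z\in\mathbb C^n$, and $q(\omega,z)\ne0$ for all $\omega\in\Omega$, $z\in U$. -/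

import Mathlib

/-- A connected Reinhardt domain in `ℂⁿ` (centered at the origin): a nonempty connected open set
that is invariant under all rotations `z ↦ (e^{iθ₁} z₁, …, e^{iθₙ} zₙ)`. -/
structure IsConnectedReinhardtDomain {n : ℕ} (U : Set (Fin n → ℂ)) : Prop where
  isOpen : IsOpen U
  isConnected : IsConnected U
  rotate_mem : ∀ z ∈ U, ∀ θ : Fin n → ℝ,
    (fun j => Complex.exp ((θ j : ℂ) * Complex.I) * z j) ∈ U

/-- A random holomorphic function on `U`: measurable in `ω` for each fixed `z ∈ U` and holomorphic
in `z ∈ U` for each fixed `ω`. Only the values `f ω z` with `z ∈ U` matter. -/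
structure IsRandomHolomorphicOn {Ω : Type*} [MeasurableSpace Ω] {n : ℕ}
    (U : Set (Fin n → ℂ)) (f : Ω → (Fin n → ℂ) → ℂ) : Prop where
  measurable : ∀ z ∈ U, Measurable fun ω => f ω z
  holomorphic : ∀ ω, DifferentiableOn ℂ (f ω) U

/-- The Laurent monomial `z^α = z₁^{α₁} ⋯ zₙ^{αₙ}`, for `α ∈ ℤⁿ`. -/
noncomputable def laurentMonomial {n : ℕ} (α : Fin n → ℤ) (z : Fin n → ℂ) : ℂ :=
  ∏ j, z j ^ α j

/-- Every term `a_α z^α` that occurs in the Laurent series `∑ a_α z^α` is defined on all of `U`: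
if `a_α ≠ 0` and `α_j < 0`, then `z_j` has no zero on `U`. -/
def LaurentTermsDefinedOn {n : ℕ} (U : Set (Fin n → ℂ)) (a : (Fin n → ℤ) → ℂ) : Prop :=
  ∀ α, a α ≠ 0 → ∀ z ∈ U, ∀ j, α j < 0 → z j ≠ 0

/-- `g(z) = ∑_α a_α z^α` for every `z ∈ U`. Summation over `ℤⁿ` is unconditional, which for complex
numbers is absolute convergence. -/
def HasLaurentExpansionOn {n : ℕ} (U : Set (Fin n → ℂ)) (a : (Fin n → ℤ) → ℂ)
    (g : (Fin n → ℂ) → ℂ) : Prop :=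
  LaurentTermsDefinedOn U a ∧
    ∀ z ∈ U, HasSum (fun α : Fin n → ℤ => a α * laurentMonomial α z) (g z)

/-- The Laurent series `∑ a_α z^α` converges normally in `U`: its terms are defined on `U`, and for
every compact `K ⊆ U` and every `ε > 0` there is a finite set `Λ` of indices such that
`∑_{α ∉ Λ} |a_α z^α| < ε` for all `z ∈ K`. -/
def LaurentConvergesNormallyOn {n : ℕ} (U : Set (Fin n → ℂ)) (a : (Fin n → ℤ) → ℂ) : Prop :=
  LaurentTermsDefinedOn U a ∧
    ∀ K ⊆ U, IsCompact K → ∀ ε : ℝ, 0 < ε → ∃ Λ : Finset (Fin n → ℤ), ∀ z ∈ K,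
      Summable (fun α : {α : Fin n → ℤ // α ∉ Λ} => ‖a α.1 * laurentMonomial α.1 z‖) ∧
        ∑' α : {α : Fin n → ℤ // α ∉ Λ}, ‖a α.1 * laurentMonomial α.1 z‖ < ε

/-- A random Laurent series: every coefficient `a_α` is a measurable function of `ω`. -/
def IsRandomLaurentSeries {Ω : Type*} [MeasurableSpace Ω] {n : ℕ}
    (a : Ω → (Fin n → ℤ) → ℂ) : Prop :=
  ∀ α, Measurable fun ω => a ω α

/-- A random polynomial: a polynomial in `z` for each `ω`, whose value at each `z` is measurable
in `ω`. -/
def IsRandomPolynomial {Ω : Type*} [MeasurableSpace Ω] {n : ℕ}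
    (p : Ω → MvPolynomial (Fin n) ℂ) : Prop :=
  ∀ z : Fin n → ℂ, Measurable fun ω => MvPolynomial.eval z (p ω)

/-- A random rational function without poles on `U`: on `U` it is a quotient of two random
polynomials, the denominator having no zeros on `U`. -/
def IsRandomRationalOn {Ω : Type*} [MeasurableSpace Ω] {n : ℕ}
    (U : Set (Fin n → ℂ)) (r : Ω → (Fin n → ℂ) → ℂ) : Prop :=
  ∃ p q : Ω → MvPolynomial (Fin n) ℂ, IsRandomPolynomial p ∧ IsRandomPolynomial q ∧
    ∀ ω, ∀ z ∈ U, MvPolynomial.eval z (q ω) ≠ 0 ∧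
      r ω z = MvPolynomial.eval z (p ω) / MvPolynomial.eval z (q ω)

open MeasureTheory Set Filter Topology

/-! On the torus through a point `w` with nonzero coordinates the Laurent monomials are constant
multiples of the characters, so a Laurent expansion of `g` restricts to a Fourier series there.
Hence its coefficients can only be the averages of `g z^{-α}` over that torus (`laurentCoeff`). This
gives uniqueness, and measurability in `ω` because the integrand is measurable in `ω` and continuous
on the torus.

For existence, Cauchy's theorem in one variable at a time shows that the averages do not change
under small changes of the torus, and connectedness of `U` makes them independent of the torus
altogether (`IsConnectedReinhardtDomain.integral_torusRotate_eq`). The torus may then be adapted to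
`α`: enlarging the radii with `α_j ≥ 0` and shrinking the others turns the trivial bound on Fourier
coefficients into geometric decay near every point of `U` (`exists_local_bound_nonzeroCoords`). This
decay rules out forbidden negative exponents, persists on the coordinate hyperplanes by continuity,
and yields normal convergence. The sum is `g` because an absolutely summable Fourier series
represents its continuous function; on the hyperplanes this follows by density.

The rational functions are the partial sums over boxes of exponents, written over a common monomial
denominator. -/

/-- The Haar probability measure on the torus `(ℝ / ℤ)ⁿ`. -/
noncomputable abbrev torusHaar (n : ℕ) : Measure (UnitAddTorus (Fin n)) :=
  Measure.pi fun _ => (AddCircle.haarAddCircle : Measure UnitAddCircle)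

/-- The point `(e^{2πiθ₁} w₁, …, e^{2πiθₙ} wₙ)`. -/
noncomputable def torusRotate {n : ℕ} (w : Fin n → ℂ) (θ : UnitAddTorus (Fin n)) : Fin n → ℂ :=
  fun j => w j * (AddCircle.toCircle (θ j) : ℂ)

/-! ### Rotations, monomials as characters, and averages over tori -/

section Rotate

variable {n : ℕ}

@[fun_prop]
lemma continuous_torusRotate (w : Fin n → ℂ) : Continuous (torusRotate w) := by
  unfold torusRotate
  have h : Continuous (fun x : UnitAddCircle => (AddCircle.toCircle x : ℂ)) :=
    continuous_subtype_val.comp AddCircle.continuous_toCircle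
  fun_prop

@[simp]
lemma norm_torusRotate_apply (w : Fin n → ℂ) (θ : UnitAddTorus (Fin n)) (j : Fin n) :
    ‖torusRotate w θ j‖ = ‖w j‖ := by
  rw [torusRotate, norm_mul, Circle.norm_coe, mul_one]

@[simp]
lemma torusRotate_zero (w : Fin n → ℂ) : torusRotate w 0 = w := by
  ext j; simp [torusRotate]

lemma torusRotate_update (w : Fin n → ℂ) (θ : UnitAddTorus (Fin n)) (j : Fin n) (s : ℂ)
    (x : UnitAddCircle) :
    torusRotate (Function.update w j s) (Function.update θ j x) =
      Function.update (torusRotate w θ) j (s * (AddCircle.toCircle x : ℂ)) := by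
  ext i
  by_cases h : i = j
  · subst h; simp [torusRotate]
  · simp [torusRotate, h]

lemma exists_torusRotate_eq {w z : Fin n → ℂ} (h : ∀ j, ‖w j‖ = ‖z j‖) :
    ∃ θ, torusRotate w θ = z := by
  have : ∀ j, ∃ x : UnitAddCircle, w j * (AddCircle.toCircle x : ℂ) = z j := by
    intro j
    rcases eq_or_ne (w j) 0 with h0 | h0
    · refine ⟨0, ?_⟩
      have := h j
      rw [h0, norm_zero] at this
      rw [h0, zero_mul, norm_eq_zero.1 this.symm]
    · obtain ⟨x, hx⟩ := (AddCircle.homeomorphCircle (one_ne_zero (α := ℝ))).surjective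
        (⟨z j / w j, by
          refine mem_sphere_zero_iff_norm.2 ?_
          rw [norm_div, ← h j, div_self (norm_ne_zero_iff.2 h0)]⟩ : Circle)
      rw [AddCircle.homeomorphCircle_apply] at hx
      refine ⟨x, ?_⟩
      rw [hx]
      exact mul_div_cancel₀ _ h0
  choose θ hθ using this
  exact ⟨θ, funext hθ⟩

/-- This turns Laurent series on a torus into Fourier series. -/
lemma laurentMonomial_torusRotate (α : Fin n → ℤ) (w : Fin n → ℂ) (θ : UnitAddTorus (Fin n)) :
    laurentMonomial α (torusRotate w θ) = laurentMonomial α w * UnitAddTorus.mFourier α θ := by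
  simp only [laurentMonomial, torusRotate, mul_zpow, Finset.prod_mul_distrib,
    UnitAddTorus.mFourier, ContinuousMap.coe_mk, fourier_apply, AddCircle.toCircle_zsmul,
    Circle.coe_zpow]

lemma laurentMonomial_neg (α : Fin n → ℤ) (w : Fin n → ℂ) :
    laurentMonomial (-α) w = (laurentMonomial α w)⁻¹ := by
  simp [laurentMonomial]

lemma laurentMonomial_ne_zero (α : Fin n → ℤ) {w : Fin n → ℂ} (hw : ∀ j, w j ≠ 0) :
    laurentMonomial α w ≠ 0 :=
  Finset.prod_ne_zero_iff.2 fun j _ => zpow_ne_zero _ (hw j)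

lemma continuousAt_laurentMonomial (α : Fin n → ℤ) {w : Fin n → ℂ}
    (hw : ∀ j, w j ≠ 0 ∨ 0 ≤ α j) : ContinuousAt (laurentMonomial α) w := by
  unfold laurentMonomial
  refine tendsto_finsetProd _ fun j _ => ?_
  exact ContinuousAt.zpow₀ (continuous_apply j).continuousAt _ (hw j)

lemma differentiableAt_laurentMonomial (α : Fin n → ℤ) {w : Fin n → ℂ}
    (hw : ∀ j, w j ≠ 0) : DifferentiableAt ℂ (laurentMonomial α) w := by
  unfold laurentMonomial
  exact (HasFDerivAt.finsetProd (u := Finset.univ) fun j _ =>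
    ((differentiableAt_apply j w).zpow (Or.inl (hw j))).hasFDerivAt).differentiableAt

/-- Averaging over one coordinate does not change the integral over the torus. -/
lemma integral_torusHaar_update {h : UnitAddTorus (Fin n) → ℂ} (hh : Continuous h) (j : Fin n) :
    ∫ θ, h θ ∂torusHaar n =
      ∫ θ, ∫ x, h (Function.update θ j x) ∂AddCircle.haarAddCircle ∂torusHaar n := by
  have e : ∀ (θ : UnitAddTorus (Fin n)) (x : UnitAddCircle),
      Function.update θ j (θ j + x) = θ + Pi.single j x := by
    intro θ x
    ext i
    by_cases hi : i = j
    · subst hi; simp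
    · simp [hi]
  have h1 : ∀ θ : UnitAddTorus (Fin n),
      ∫ x, h (Function.update θ j x) ∂AddCircle.haarAddCircle =
        ∫ x, h (θ + Pi.single j x) ∂AddCircle.haarAddCircle := by
    intro θ
    -- Invariance on the circle replaces the inserted coordinate by `θ j + x`, a translate of `θ`;
    -- after Fubini, invariance on the torus removes the translation.
    rw [← integral_add_left_eq_self (fun x => h (Function.update θ j x)) (θ j)]
    simp only [e]
  simp_rw [h1]
  rw [integral_integral_swap]
  · simp_rw [integral_add_right_eq_self h]
    simp
  · have hc : Continuous (Function.uncurry fun (θ : UnitAddTorus (Fin n)) (x : UnitAddCircle) =>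
        h (θ + Pi.single j x)) := by
      have : Continuous fun x : UnitAddCircle => (Pi.single j x : UnitAddTorus (Fin n)) :=
        continuous_single (A := fun _ : Fin n => UnitAddCircle) j
      unfold Function.uncurry
      exact hh.comp (continuous_fst.add (this.comp continuous_snd))
    exact hc.integrable_of_hasCompactSupport (HasCompactSupport.of_compactSpace _)

/-- Substitute `z = s e^{2πix}`, for which `dz / z = 2πi dx`. -/
lemma integral_haarAddCircle_eq_circleIntegral (H : ℂ → ℂ) {s : ℝ} (hs : s ≠ 0) :
    ∫ x : UnitAddCircle, H (s * (AddCircle.toCircle x : ℂ)) ∂AddCircle.haarAddCircle =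
      (2 * Real.pi * Complex.I)⁻¹ * ∮ z in C(0, s), (z - 0)⁻¹ • H z := by
  have hvol : (AddCircle.haarAddCircle : Measure UnitAddCircle) = volume := by
    rw [AddCircle.volume_eq_smul_haarAddCircle]; simp
  rw [hvol, ← UnitAddCircle.intervalIntegral_preimage 0]
  have h1 : ∀ a : ℝ, H (s * (AddCircle.toCircle (a : UnitAddCircle) : ℂ)) =
      H (circleMap 0 s (2 * Real.pi * a)) := by
    intro a
    rw [AddCircle.toCircle_apply_mk]
    simp [circleMap]
  simp_rw [h1]
  rw [intervalIntegral.integral_comp_mul_left (fun t => H (circleMap 0 s t))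
    (by positivity : (2 * Real.pi) ≠ 0)]
  rw [circleIntegral_def_Icc]
  rw [integral_Icc_eq_integral_Ioc, ← intervalIntegral.integral_of_le (by positivity)]
  have h2 : ∀ t : ℝ, deriv (circleMap 0 s) t • (circleMap 0 s t - 0)⁻¹ • H (circleMap 0 s t) =
      Complex.I * H (circleMap 0 s t) := by
    intro t
    have : circleMap 0 s t ≠ 0 := by simpa using hs
    simp only [deriv_circleMap, smul_eq_mul, sub_zero]
    field_simp
  simp_rw [h2]
  rw [intervalIntegral.integral_const_mul]
  have : (Real.pi : ℂ) ≠ 0 := by exact_mod_cast Real.pi_ne_zero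
  simp only [zero_add, mul_zero, mul_one, Complex.real_smul]
  push_cast
  field_simp

/-- The torus average depends on `w` only through `|w_j|`. -/
lemma integral_torusRotate_congr_norm (F : (Fin n → ℂ) → ℂ) {w z : Fin n → ℂ}
    (h : ∀ j, ‖w j‖ = ‖z j‖) :
    ∫ θ, F (torusRotate w θ) ∂torusHaar n = ∫ θ, F (torusRotate z θ) ∂torusHaar n := by
  obtain ⟨θ₀, rfl⟩ := exists_torusRotate_eq h
  rw [← integral_add_left_eq_self _ θ₀]
  congr 1
  ext θ
  congr 1
  ext j
  simp [torusRotate, AddCircle.toCircle_add, mul_assoc]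

end Rotate

/-! ### Polyshells in Reinhardt domains and independence of the torus -/

section Shells

variable {n : ℕ}

/-- The points `z` with `|‖z_j‖ - ‖z₀_j‖| ≤ ρ` for all `j`. -/
def closedPolyShell (z₀ : Fin n → ℂ) (ρ : ℝ) : Set (Fin n → ℂ) :=
  {z | ∀ j, |‖z j‖ - ‖z₀ j‖| ≤ ρ}

/-- The points `z` with `|‖z_j‖ - ‖z₀_j‖| < ρ` for all `j`. -/
def polyShell (z₀ : Fin n → ℂ) (ρ : ℝ) : Set (Fin n → ℂ) :=
  {z | ∀ j, |‖z j‖ - ‖z₀ j‖| < ρ}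

lemma polyShell_subset_closedPolyShell (z₀ : Fin n → ℂ) (ρ : ℝ) :
    polyShell z₀ ρ ⊆ closedPolyShell z₀ ρ := fun _ hz j => (hz j).le

lemma mem_polyShell_self (z₀ : Fin n → ℂ) {ρ : ℝ} (hρ : 0 < ρ) : z₀ ∈ polyShell z₀ ρ := by
  intro j; simpa using hρ

lemma isOpen_polyShell (z₀ : Fin n → ℂ) (ρ : ℝ) : IsOpen (polyShell z₀ ρ) := by
  have : polyShell z₀ ρ = ⋂ j, {z | |‖z j‖ - ‖z₀ j‖| < ρ} := by
    ext z; simp [polyShell]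
  rw [this]
  exact isOpen_iInter_of_finite fun j => isOpen_lt (by fun_prop) continuous_const

lemma isCompact_closedPolyShell (z₀ : Fin n → ℂ) (ρ : ℝ) :
    IsCompact (closedPolyShell z₀ ρ) := by
  have h : closedPolyShell z₀ ρ = ⋂ j, {z | |‖z j‖ - ‖z₀ j‖| ≤ ρ} := by
    ext z; simp [closedPolyShell]
  have hc : IsClosed (closedPolyShell z₀ ρ) := by
    rw [h]
    exact isClosed_iInter fun j => isClosed_le (by fun_prop) continuous_const
  refine Metric.isCompact_of_isClosed_isBounded hc ?_
  refine (Metric.isBounded_closedBall (x := (0 : Fin n → ℂ)) (r := |‖z₀‖ + ρ|)).subset ?_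
  intro z hz
  rw [mem_closedBall_zero_iff, pi_norm_le_iff_of_nonneg (abs_nonneg _)]
  intro j
  have h1 := (abs_le.1 (hz j)).2
  have h2 := norm_le_pi_norm z₀ j
  exact le_trans (by linarith) (le_abs_self _)

/-- The points all of whose coordinates are nonzero. -/
def nonzeroCoords (n : ℕ) : Set (Fin n → ℂ) := {w | ∀ j, w j ≠ 0}

lemma isOpen_nonzeroCoords : IsOpen (nonzeroCoords n) := by
  have : nonzeroCoords n = ⋂ j, {w | w j ≠ 0} := by ext; simp [nonzeroCoords]
  rw [this]
  exact isOpen_iInter_of_finite fun j => isOpen_ne_fun (by fun_prop) continuous_const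

lemma dense_nonzeroCoords : Dense (nonzeroCoords n) := by
  have : nonzeroCoords n = Set.pi univ fun _ => {(0 : ℂ)}ᶜ := by ext; simp [nonzeroCoords]
  rw [this]
  exact dense_pi _ fun _ _ => dense_compl_singleton _

namespace IsConnectedReinhardtDomain

variable {U : Set (Fin n → ℂ)} 

lemma torusRotate_mem (hU : IsConnectedReinhardtDomain U) {z : Fin n → ℂ} (hz : z ∈ U) (θ : UnitAddTorus (Fin n)) :
    torusRotate z θ ∈ U := by
  choose t ht using fun j => QuotientAddGroup.mk_surjective (θ j)
  convert hU.rotate_mem z hz (fun j => 2 * Real.pi * t j) using 1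
  ext j
  have : θ j = ((t j : ℝ) : UnitAddCircle) := (ht j).symm
  rw [torusRotate, this, AddCircle.toCircle_apply_mk, Circle.coe_exp, mul_comm]
  simp

/-- The torus orbit of `z₀` is compact, so a closed thickening of it lies in `U`. Adjusting moduli
radially, coordinate by coordinate, shows that points with moduli close to those of `z₀` are close
to this orbit. -/
lemma exists_closedPolyShell_subset (hU : IsConnectedReinhardtDomain U) {z₀ : Fin n → ℂ} (hz₀ : z₀ ∈ U) :
    ∃ ρ : ℝ, 0 < ρ ∧ closedPolyShell z₀ ρ ⊆ U := by
  have hcomp : IsCompact (range (torusRotate z₀)) :=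
    isCompact_range (continuous_torusRotate z₀)
  have hsub : range (torusRotate z₀) ⊆ U := by
    rintro _ ⟨θ, rfl⟩
    exact hU.torusRotate_mem hz₀ θ
  obtain ⟨δ, hδ, hsubδ⟩ := hcomp.exists_cthickening_subset_open hU.isOpen hsub
  refine ⟨δ, hδ, fun z hz => hsubδ ?_⟩
  have hy : ∀ j, ∃ y : ℂ, ‖z₀ j‖ = ‖y‖ ∧ dist (z j) y ≤ δ := by
    intro j
    have hj := hz j
    rcases eq_or_ne (z j) 0 with h0 | h0
    · refine ⟨z₀ j, rfl, ?_⟩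
      simpa [h0] using hj
    · have hn : ‖z j‖ ≠ 0 := norm_ne_zero_iff.2 h0
      refine ⟨(‖z₀ j‖ / ‖z j‖ : ℝ) * z j, ?_, ?_⟩
      · rw [norm_mul, Complex.norm_real, Real.norm_eq_abs, abs_div, abs_norm, abs_norm,
          div_mul_cancel₀ _ hn]
      · have : z j - (‖z₀ j‖ / ‖z j‖ : ℝ) * z j = ((1 - ‖z₀ j‖ / ‖z j‖ : ℝ) : ℂ) * z j := by
          push_cast; ring
        rw [dist_eq_norm, this, norm_mul, Complex.norm_real, Real.norm_eq_abs,
          ← abs_norm (z j), ← abs_mul, abs_norm, sub_mul, one_mul, div_mul_cancel₀ _ hn]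
        exact hj
  choose y hy1 hy2 using hy
  refine Metric.mem_cthickening_of_dist_le z y δ _ (exists_torusRotate_eq hy1) ?_
  exact (dist_pi_le_iff hδ.le).2 hy2

end IsConnectedReinhardtDomain

/-- Cauchy's theorem for an annulus, in the `j`-th coordinate of a torus average. -/
lemma integral_torusRotate_update_eq {F : (Fin n → ℂ) → ℂ} {V : Set (Fin n → ℂ)}
    (hV : IsOpen V) (hF : DifferentiableOn ℂ F V) (w : Fin n → ℂ) (j : Fin n) {s t : ℝ}
    (hs : 0 < s) (hst : s ≤ t)
    (h : ∀ z : Fin n → ℂ, (∀ i, i ≠ j → ‖z i‖ = ‖w i‖) → s ≤ ‖z j‖ → ‖z j‖ ≤ t → z ∈ V) :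
    ∫ θ, F (torusRotate (Function.update w j s) θ) ∂torusHaar n =
      ∫ θ, F (torusRotate (Function.update w j t) θ) ∂torusHaar n := by
  have key : ∀ r : ℝ, s ≤ r → r ≤ t →
      ∫ θ, F (torusRotate (Function.update w j r) θ) ∂torusHaar n =
        ∫ θ, (2 * Real.pi * Complex.I)⁻¹ * ∮ z in C(0, r), (z - 0)⁻¹ •
          F (Function.update (torusRotate w θ) j z) ∂torusHaar n := by
    intro r hsr hrt
    have hr : 0 < r := hs.trans_le hsr
    have hmem : ∀ θ, torusRotate (Function.update w j r) θ ∈ V := by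
      intro θ
      refine h _ (fun i hi => by simp [hi]) ?_ ?_ <;> simpa [abs_of_pos hr]
    have hcont : Continuous fun θ => F (torusRotate (Function.update w j r) θ) :=
      hF.continuousOn.comp_continuous (continuous_torusRotate _) hmem
    rw [integral_torusHaar_update hcont j]
    simp_rw [torusRotate_update]
    congr 1
    ext θ
    exact integral_haarAddCircle_eq_circleIntegral
      (fun z => F (Function.update (torusRotate w θ) j z)) hr.ne'
  rw [key s le_rfl hst, key t hst le_rfl]
  congr 1
  ext θ
  congr 1
  have hd : ∀ z : ℂ, s ≤ ‖z‖ → ‖z‖ ≤ t →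
      DifferentiableAt ℂ (fun z => F (Function.update (torusRotate w θ) j z)) z := by
    intro z h1 h2
    have hz : Function.update (torusRotate w θ) j z ∈ V := by
      refine h _ (fun i hi => by simp [hi]) ?_ ?_ <;> simpa
    refine DifferentiableAt.comp z (hF.differentiableAt (hV.mem_nhds hz)) ?_
    exact (hasFDerivAt_update _ _).differentiableAt
  -- With the other coordinates fixed, the function of `z` is holomorphic on the closed annulus `s ≤
  -- |z| ≤ t`, so its integrals against `dz / z` over the two boundary circles agree.
  refine (Complex.circleIntegral_sub_center_inv_smul_eq_of_differentiable_on_annulus_off_countable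
    hs hst countable_empty ?_ ?_).symm
  · rintro z ⟨h1, h2⟩
    refine (hd z ?_ ?_).continuousAt.continuousWithinAt
    · simpa using h2
    · simpa using h1
  · rintro z ⟨⟨h1, h2⟩, -⟩
    refine hd z ?_ ?_
    · have := h2; simp at this; exact this.le
    · have := h1; simp at this; exact this.le

lemma integral_torusRotate_update_eq_self {F : (Fin n → ℂ) → ℂ} {z₀ : Fin n → ℂ} {ρ : ℝ}
    (hF : DifferentiableOn ℂ F (polyShell z₀ ρ ∩ nonzeroCoords n))
    {w : Fin n → ℂ} (hw : w ∈ polyShell z₀ ρ ∩ nonzeroCoords n) (j : Fin n) {c : ℂ}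
    (hc : |‖c‖ - ‖z₀ j‖| < ρ) (hc0 : c ≠ 0) :
    ∫ θ, F (torusRotate (Function.update w j c) θ) ∂torusHaar n =
      ∫ θ, F (torusRotate w θ) ∂torusHaar n := by
  have hopen := (isOpen_polyShell z₀ ρ).inter (isOpen_nonzeroCoords (n := n))
  have e1 : ∫ θ, F (torusRotate (Function.update w j c) θ) ∂torusHaar n =
      ∫ θ, F (torusRotate (Function.update w j (‖c‖ : ℝ)) θ) ∂torusHaar n := by
    refine integral_torusRotate_congr_norm F fun i => ?_
    by_cases hi : i = j
    · subst hi; simp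
    · simp [hi]
  have e2 : ∫ θ, F (torusRotate w θ) ∂torusHaar n =
      ∫ θ, F (torusRotate (Function.update w j (‖w j‖ : ℝ)) θ) ∂torusHaar n := by
    refine integral_torusRotate_congr_norm F fun i => ?_
    by_cases hi : i = j
    · subst hi; simp
    · simp [hi]
  have hcpos : 0 < ‖c‖ := norm_pos_iff.2 hc0
  have hwpos : 0 < ‖w j‖ := norm_pos_iff.2 (hw.2 j)
  have hwj := abs_lt.1 (hw.1 j)
  have hcj := abs_lt.1 hc
  have hmem : ∀ s t : ℝ, 0 < s → -ρ < s - ‖z₀ j‖ → t - ‖z₀ j‖ < ρ → ∀ z : Fin n → ℂ,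
      (∀ i, i ≠ j → ‖z i‖ = ‖w i‖) → s ≤ ‖z j‖ → ‖z j‖ ≤ t →
      z ∈ polyShell z₀ ρ ∩ nonzeroCoords n := by
    intro s t hs h1 h2 z hz h3 h4
    refine ⟨fun i => ?_, fun i => ?_⟩
    · by_cases hi : i = j
      · subst hi
        exact abs_lt.2 ⟨by linarith, by linarith⟩
      · rw [hz i hi]; exact hw.1 i
    · rw [← norm_pos_iff]
      by_cases hi : i = j
      · subst hi
        linarith
      · rw [hz i hi]; exact norm_pos_iff.2 (hw.2 i)
  rw [e1, e2]
  rcases le_total ‖c‖ ‖w j‖ with hle | hle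
  · exact integral_torusRotate_update_eq hopen hF w j hcpos hle
      (hmem _ _ hcpos hcj.1 hwj.2)
  · exact (integral_torusRotate_update_eq hopen hF w j hwpos hle
      (hmem _ _ hwpos hwj.1 hcj.2)).symm

/-- A shell is a product, so `w` can be changed into `w'` one coordinate at a time without leaving
it. -/
lemma integral_torusRotate_eq_of_mem_polyShell {F : (Fin n → ℂ) → ℂ} {z₀ : Fin n → ℂ} {ρ : ℝ}
    (hF : DifferentiableOn ℂ F (polyShell z₀ ρ ∩ nonzeroCoords n))
    {w w' : Fin n → ℂ} (hw : w ∈ polyShell z₀ ρ ∩ nonzeroCoords n)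
    (hw' : w' ∈ polyShell z₀ ρ ∩ nonzeroCoords n) :
    ∫ θ, F (torusRotate w' θ) ∂torusHaar n = ∫ θ, F (torusRotate w θ) ∂torusHaar n := by
  have key : ∀ S : Finset (Fin n),
      ∫ θ, F (torusRotate (S.piecewise w' w) θ) ∂torusHaar n =
        ∫ θ, F (torusRotate w θ) ∂torusHaar n := by
    intro S
    induction S using Finset.induction_on with
    | empty => simp
    | insert j S hj ih =>
      rw [Finset.piecewise_insert, integral_torusRotate_update_eq_self hF ?_ j (hw'.1 j) (hw'.2 j),
        ih]
      refine ⟨fun i => ?_, fun i => ?_⟩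
      · by_cases hi : i ∈ S
        · simpa [hi] using hw'.1 i
        · simpa [hi] using hw.1 i
      · by_cases hi : i ∈ S
        · simpa [hi] using hw'.2 i
        · simpa [hi] using hw.2 i
  simpa using key Finset.univ

/-- Torus averages of a holomorphic function on a connected Reinhardt domain do not depend on the
torus. -/
lemma IsConnectedReinhardtDomain.integral_torusRotate_eq {U : Set (Fin n → ℂ)}
    (hU : IsConnectedReinhardtDomain U) {F : (Fin n → ℂ) → ℂ}
    (hF : DifferentiableOn ℂ F (U ∩ nonzeroCoords n)) {w w' : Fin n → ℂ}
    (hw : w ∈ U ∩ nonzeroCoords n) (hw' : w' ∈ U ∩ nonzeroCoords n) :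
    ∫ θ, F (torusRotate w θ) ∂torusHaar n = ∫ θ, F (torusRotate w' θ) ∂torusHaar n := by
  -- The local constant `c` is defined at every point of `U`, including those on the hyperplanes,
  -- through nearby points with nonzero coordinates. Thus connectedness of `U` itself suffices.
  -- Outside `U` the values are irrelevant.
  have hloc : ∀ z : Fin n → ℂ, ∃ (c : ℂ) (ρ : ℝ), z ∈ U → 0 < ρ ∧
      ∀ w ∈ polyShell z ρ ∩ nonzeroCoords n, ∫ θ, F (torusRotate w θ) ∂torusHaar n = c := by
    intro z
    by_cases hz : z ∈ U
    · obtain ⟨ρ, hρ, hsub⟩ := hU.exists_closedPolyShell_subset hz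
      have hsub' := (polyShell_subset_closedPolyShell z ρ).trans hsub
      obtain ⟨v, hv1, hv2⟩ := dense_nonzeroCoords.inter_open_nonempty _ (isOpen_polyShell z ρ)
        ⟨z, mem_polyShell_self z hρ⟩
      refine ⟨∫ θ, F (torusRotate v θ) ∂torusHaar n, ρ, fun _ => ⟨hρ, fun w hw => ?_⟩⟩
      exact integral_torusRotate_eq_of_mem_polyShell
        (hF.mono (inter_subset_inter_left _ hsub')) ⟨hv1, hv2⟩ hw
    · exact ⟨0, 0, fun h => absurd h hz⟩
  choose c ρ hcρ using hloc
  have hc : c w = c w' := by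
    refine hU.isConnected.isPreconnected.induction₂ (fun x y => c x = c y) ?_ ?_ ?_ hw.1 hw'.1
    · intro x hx
      filter_upwards [mem_nhdsWithin_of_mem_nhds ((isOpen_polyShell x (ρ x)).mem_nhds
        (mem_polyShell_self x (hcρ x hx).1)), self_mem_nhdsWithin] with y hy hyU
      -- Both local constants are the average over the torus through a common point `v` of the two
      -- shells.
      obtain ⟨v, hv1, hv2⟩ := dense_nonzeroCoords.inter_open_nonempty _
        ((isOpen_polyShell x (ρ x)).inter (isOpen_polyShell y (ρ y)))
        ⟨y, hy, mem_polyShell_self y (hcρ y hyU).1⟩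
      rw [← (hcρ x hx).2 v ⟨hv1.1, hv2⟩, ← (hcρ y hyU).2 v ⟨hv1.2, hv2⟩]
    · intro x y z _ _ _ h1 h2; exact h1.trans h2
    · intro x y _ _ h; exact h.symm
  rw [(hcρ w hw.1).2 w ⟨mem_polyShell_self w (hcρ w hw.1).1, hw.2⟩, hc,
    (hcρ w' hw'.1).2 w' ⟨mem_polyShell_self w' (hcρ w' hw'.1).1, hw'.2⟩]

end Shells

/-! ### Laurent coefficients as Fourier coefficients -/

section Coefficients

variable {n : ℕ}

/-- The `α`-th Laurent coefficient of `g`, computed by integration over the torus through `w`. -/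
noncomputable def laurentCoeff (g : (Fin n → ℂ) → ℂ) (w : Fin n → ℂ) (α : Fin n → ℤ) : ℂ :=
  ∫ θ, g (torusRotate w θ) * laurentMonomial (-α) (torusRotate w θ) ∂torusHaar n

lemma laurentCoeff_mul_laurentMonomial (g : (Fin n → ℂ) → ℂ) {w : Fin n → ℂ}
    (hw : w ∈ nonzeroCoords n) (α : Fin n → ℤ) :
    laurentCoeff g w α * laurentMonomial α w =
      UnitAddTorus.mFourierCoeff (fun θ => g (torusRotate w θ)) α := by
  have h := laurentMonomial_ne_zero α hw
  rw [laurentCoeff, ← integral_mul_const]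
  change _ = ∫ θ, _ ∂torusHaar n
  congr 1
  ext θ
  rw [laurentMonomial_torusRotate, laurentMonomial_neg, smul_eq_mul]
  field_simp

lemma norm_laurentCoeff_mul_laurentMonomial_le {g : (Fin n → ℂ) → ℂ} {w : Fin n → ℂ}
    (hw : w ∈ nonzeroCoords n) {M : ℝ} (hM : ∀ θ, ‖g (torusRotate w θ)‖ ≤ M)
    (α : Fin n → ℤ) : ‖laurentCoeff g w α * laurentMonomial α w‖ ≤ M := by
  rw [laurentCoeff_mul_laurentMonomial g hw]
  change ‖∫ θ, _ ∂torusHaar n‖ ≤ M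
  refine (norm_integral_le_of_norm_le_const (C := M) (ae_of_all _ fun θ => ?_)).trans (by simp)
  rw [norm_smul]
  have : ‖UnitAddTorus.mFourier (-α) θ‖ ≤ 1 :=
    ((UnitAddTorus.mFourier (-α)).norm_coe_le_norm θ).trans UnitAddTorus.mFourier_norm.le
  calc _ ≤ 1 * ‖g (torusRotate w θ)‖ := by gcongr
    _ ≤ M := by rw [one_mul]; exact hM θ

/-- A Laurent series converging on a torus has coefficients given by integrals. -/
lemma laurentCoeff_eq_of_hasSum {g : (Fin n → ℂ) → ℂ} {w : Fin n → ℂ}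
    (hw : w ∈ nonzeroCoords n) {c : (Fin n → ℤ) → ℂ}
    (h : ∀ θ, HasSum (fun α => c α * laurentMonomial α (torusRotate w θ)) (g (torusRotate w θ)))
    (β : Fin n → ℤ) : laurentCoeff g w β = c β := by
  classical
  set b : (Fin n → ℤ) → ℂ := fun α => c α * laurentMonomial α w with hb
  have hsum : Summable fun α => ‖b α‖ := by
    have := (h 0).summable.norm
    simpa [hb] using this
  have hnorm : ∀ α θ, ‖UnitAddTorus.mFourier α θ‖ ≤ (1 : ℝ) := fun (α : Fin n → ℤ) θ =>
    ((UnitAddTorus.mFourier α).norm_coe_le_norm θ).trans UnitAddTorus.mFourier_norm.le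
  have hterm : ∀ α θ, c α * laurentMonomial α (torusRotate w θ) *
      laurentMonomial (-β) (torusRotate w θ) =
      (laurentMonomial β w)⁻¹ * b α * UnitAddTorus.mFourier (α + -β) θ := by
    intro α θ
    rw [laurentMonomial_torusRotate, laurentMonomial_torusRotate, laurentMonomial_neg,
      UnitAddTorus.mFourier_add, hb]
    ring
  -- Characters have modulus at most one, so absolute convergence at `w` alone permits termwise
  -- integration over the torus.
  have hint := hasSum_integral_of_summable_integral_norm (μ := torusHaar n)
    (F := fun α θ => (laurentMonomial β w)⁻¹ * b α * UnitAddTorus.mFourier (α + -β) θ) ?_ ?_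
  rotate_left
  · intro α
    exact (Continuous.integrable_of_hasCompactSupport (by fun_prop)
      (HasCompactSupport.of_compactSpace _))
  · refine Summable.of_nonneg_of_le (fun α => integral_nonneg fun θ => norm_nonneg _)
      (fun α => ?_) (hsum.mul_left ‖(laurentMonomial β w)⁻¹‖)
    have hle : ∀ θ, ‖(laurentMonomial β w)⁻¹ * b α * UnitAddTorus.mFourier (α + -β) θ‖ ≤
        ‖(laurentMonomial β w)⁻¹‖ * ‖b α‖ := by
      intro θ
      rw [norm_mul, norm_mul]
      exact mul_le_of_le_one_right (by positivity) (hnorm _ _)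
    refine (integral_mono_of_nonneg (ae_of_all _ fun θ => norm_nonneg _)
      (integrable_const _) (ae_of_all _ hle)).trans (by simp)
  have hL : laurentCoeff g w β = ∫ θ, ∑' α, (laurentMonomial β w)⁻¹ * b α *
      UnitAddTorus.mFourier (α + -β) θ ∂torusHaar n := by
    rw [laurentCoeff]
    congr 1
    ext θ
    rw [← ((h θ).mul_right (laurentMonomial (-β) (torusRotate w θ))).tsum_eq]
    simp_rw [hterm]
  rw [hL, ← hint.tsum_eq]
  have hone : ∀ α, ∫ θ, (laurentMonomial β w)⁻¹ * b α *
      UnitAddTorus.mFourier (α + -β) θ ∂torusHaar n = if α = β then c β else 0 := by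
    intro α
    have ho := orthonormal_iff_ite.1 (UnitAddTorus.orthonormal_mFourier (d := Fin n)) β α
    rw [ContinuousMap.inner_toLp] at ho
    rw [integral_const_mul]
    have : ∫ θ, UnitAddTorus.mFourier (α + -β) θ ∂torusHaar n = if β = α then 1 else 0 := by
      rw [← ho]
      change _ = ∫ θ, _ ∂torusHaar n
      congr 1
      ext θ
      rw [UnitAddTorus.mFourier_add, UnitAddTorus.mFourier_neg]
    rw [this]
    have hne := laurentMonomial_ne_zero β hw
    by_cases hαβ : α = β
    · subst hαβ
      simp only [if_true, hb]
      field_simp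
    · rw [if_neg hαβ, if_neg (Ne.symm hαβ), mul_zero]
  simp_rw [hone]
  exact tsum_ite_eq β _

lemma hasSum_laurentCoeff_of_summable {g : (Fin n → ℂ) → ℂ} {w : Fin n → ℂ}
    (hw : w ∈ nonzeroCoords n) (hg : Continuous fun θ => g (torusRotate w θ))
    (hs : Summable fun α => laurentCoeff g w α * laurentMonomial α w) :
    HasSum (fun α => laurentCoeff g w α * laurentMonomial α w) (g w) := by
  simp_rw [laurentCoeff_mul_laurentMonomial g hw] at hs ⊢
  have := UnitAddTorus.hasSum_mFourier_series_apply_of_summable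
    (f := ⟨fun θ => g (torusRotate w θ), hg⟩) hs 0
  simpa [UnitAddTorus.mFourier] using this

lemma measurable_laurentCoeff {Ω : Type*} [MeasurableSpace Ω] {f : Ω → (Fin n → ℂ) → ℂ}
    {w : Fin n → ℂ}
    (hm : ∀ θ, Measurable fun ω => f ω (torusRotate w θ))
    (hc : ∀ ω, Continuous fun θ => f ω (torusRotate w θ)) (α : Fin n → ℤ) :
    Measurable fun ω => laurentCoeff (f ω) w α := by
  have hmono : Continuous fun θ => laurentMonomial (-α) (torusRotate w θ) := by
    simp_rw [laurentMonomial_torusRotate]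
    fun_prop
  have h := measurable_uncurry_of_continuous_of_measurable
    (u := fun (θ : UnitAddTorus (Fin n)) ω =>
      f ω (torusRotate w θ) * laurentMonomial (-α) (torusRotate w θ))
    (fun ω => (hc ω).mul hmono) (fun θ => (hm θ).mul_const _)
  have h2 : Measurable fun p : Ω × UnitAddTorus (Fin n) =>
      f p.1 (torusRotate w p.2) * laurentMonomial (-α) (torusRotate w p.2) :=
    h.comp measurable_swap
  exact (h2.stronglyMeasurable.integral_prod_right' (ν := torusHaar n)).measurable

/-- A finite set of multi-indices lies in the product of its projections, where the sum factors into
one-dimensional geometric sums. -/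
lemma summable_prod_pow_natAbs {q : ℝ} (hq0 : 0 ≤ q) (hq1 : q < 1) :
    Summable fun α : Fin n → ℤ => ∏ j, q ^ (α j).natAbs := by
  classical
  have h1 : Summable fun k : ℤ => q ^ k.natAbs := by
    refine Summable.of_nat_of_neg ?_ ?_ <;>
      simpa using summable_geometric_of_lt_one hq0 hq1
  refine summable_of_sum_le (c := (∑' k : ℤ, q ^ k.natAbs) ^ n)
    (fun α => Finset.prod_nonneg fun j _ => pow_nonneg hq0 _) fun u => ?_
  have hsub : u ⊆ Fintype.piFinset fun j : Fin n => u.image fun α => α j := by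
    intro α hα
    rw [Fintype.mem_piFinset]
    exact fun j => Finset.mem_image_of_mem _ hα
  calc ∑ α ∈ u, ∏ j, q ^ (α j).natAbs
      ≤ ∑ α ∈ Fintype.piFinset fun j : Fin n => u.image fun α => α j,
          ∏ j, q ^ (α j).natAbs :=
        Finset.sum_le_sum_of_subset_of_nonneg hsub fun α _ _ =>
          Finset.prod_nonneg fun j _ => pow_nonneg hq0 _
    _ = ∏ j : Fin n, ∑ k ∈ u.image fun α => α j, q ^ k.natAbs :=
        (Finset.prod_univ_sum (fun j : Fin n => u.image fun α => α j)
          (fun _ k => q ^ Int.natAbs k)).symm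
    _ ≤ ∏ _j : Fin n, ∑' k : ℤ, q ^ k.natAbs :=
        Finset.prod_le_prod (fun j _ => Finset.sum_nonneg fun k _ => pow_nonneg hq0 _)
          fun j _ => h1.sum_le_tsum _ fun k _ => pow_nonneg hq0 _
    _ = _ := by simp

end Coefficients

/-! ### Cauchy estimates, normal convergence and uniqueness -/

section Expansion

variable {n : ℕ} {U : Set (Fin n → ℂ)}

namespace IsConnectedReinhardtDomain

lemma laurentCoeff_eq (hU : IsConnectedReinhardtDomain U) {g : (Fin n → ℂ) → ℂ}
    (hg : DifferentiableOn ℂ g U) {w w' : Fin n → ℂ} (hw : w ∈ U ∩ nonzeroCoords n)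
    (hw' : w' ∈ U ∩ nonzeroCoords n) (α : Fin n → ℤ) :
    laurentCoeff g w α = laurentCoeff g w' α := by
  refine hU.integral_torusRotate_eq (F := fun z => g z * laurentMonomial (-α) z) ?_ hw hw'
  refine (hg.mono inter_subset_left).mul fun z hz => ?_
  exact (differentiableAt_laurentMonomial _ hz.2).differentiableWithinAt

/-- Cauchy's estimates, locally uniformly, away from the coordinate hyperplanes. -/
lemma exists_local_bound_nonzeroCoords (hU : IsConnectedReinhardtDomain U)
    {g : (Fin n → ℂ) → ℂ} (hg : DifferentiableOn ℂ g U) {a : (Fin n → ℤ) → ℂ}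
    (ha : ∀ w ∈ U ∩ nonzeroCoords n, ∀ α, laurentCoeff g w α = a α) {z₀ : Fin n → ℂ}
    (hz₀ : z₀ ∈ U) :
    ∃ N ⊆ U, IsOpen N ∧ z₀ ∈ N ∧ ∃ M q : ℝ, 0 < q ∧ q < 1 ∧
      ∀ z ∈ N ∩ nonzeroCoords n, ∀ α,
        ‖a α * laurentMonomial α z‖ ≤ M * ∏ j, q ^ (α j).natAbs := by
  obtain ⟨ρ, hρ, hsub⟩ := hU.exists_closedPolyShell_subset hz₀
  obtain ⟨M, hM⟩ := (isCompact_closedPolyShell z₀ ρ).exists_bound_of_continuousOn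
    (hg.continuousOn.mono hsub)
  -- `B` bounds the moduli of coordinates on the half-size shell, and `l` is chosen with `(l - 1) B
  -- = ρ / 2`: scaling a coordinate by `l` or `l⁻¹` keeps the point in the shell of size `ρ`.
  set B : ℝ := ‖z₀‖ + ρ / 2 with hB
  have hBpos : 0 < B := by positivity
  set l : ℝ := 1 + ρ / 2 / B with hl
  have hl1 : 1 < l := by rw [hl]; have : 0 < ρ / 2 / B := by positivity
                         linarith
  have hl0 : 0 < l := by linarith
  have hlB : (l - 1) * B = ρ / 2 := by rw [hl]; field_simp; ring
  refine ⟨polyShell z₀ (ρ / 2), fun z hz => hsub fun j => (hz j).le.trans (by linarith),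
    isOpen_polyShell _ _, mem_polyShell_self _ (by positivity), M, l⁻¹, by positivity,
    inv_lt_one_of_one_lt₀ hl1, ?_⟩
  rintro z ⟨hz, hz0⟩ α
  -- The scaling direction follows the sign of `α j`, so that `s j ^ α j = l ^ |α j|` in both cases;
  -- the bound `M` at the scaled point then gains the factor `∏ l ^ (-|α j|)` at `z`.
  set s : Fin n → ℝ := fun j => if 0 ≤ α j then l else l⁻¹ with hs
  have hspos : ∀ j, 0 < s j := fun j => by
    simp only [hs]; split_ifs <;> positivity
  have hsz : ∀ j, s j ^ α j = l ^ (α j).natAbs := fun j => by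
    simp only [hs]
    split_ifs with h
    · rw [← zpow_natCast, Int.natAbs_of_nonneg h]
    · rw [← zpow_natCast, inv_zpow', Int.ofNat_natAbs_of_nonpos (by linarith)]
  set w : Fin n → ℂ := fun j => (s j : ℂ) * z j with hw
  have hwnorm : ∀ j, ‖w j‖ = s j * ‖z j‖ := fun j => by
    rw [hw, norm_mul, Complex.norm_real, Real.norm_eq_abs, abs_of_pos (hspos j)]
  have hw0 : w ∈ nonzeroCoords n := fun j =>
    mul_ne_zero (Complex.ofReal_ne_zero.2 (hspos j).ne') (hz0 j)
  have hwshell : w ∈ closedPolyShell z₀ ρ := by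
    intro j
    rw [hwnorm]
    have h1 := abs_lt.1 (hz j)
    have h2 := norm_le_pi_norm z₀ j
    have h3 : ‖z j‖ ≤ B := by rw [hB]; linarith
    have h4 : (l - 1) * ‖z j‖ ≤ ρ / 2 := by
      rw [← hlB]; exact mul_le_mul_of_nonneg_left h3 (by linarith)
    have h5 : 0 ≤ ‖z j‖ := norm_nonneg _
    have h6 : |s j - 1| ≤ l - 1 := by
      simp only [hs]
      split_ifs
      · rw [abs_of_pos (by linarith)]
      · have h7 : l⁻¹ < 1 := inv_lt_one_of_one_lt₀ hl1
        rw [abs_of_neg (by linarith)]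
        have h8 : l * l⁻¹ = 1 := mul_inv_cancel₀ hl0.ne'
        nlinarith
    have h9 : |s j * ‖z j‖ - ‖z j‖| ≤ ρ / 2 := by
      have : s j * ‖z j‖ - ‖z j‖ = (s j - 1) * ‖z j‖ := by ring
      rw [this, abs_mul, abs_norm]
      exact (mul_le_mul_of_nonneg_right h6 h5).trans h4
    calc |s j * ‖z j‖ - ‖z₀ j‖| ≤ |s j * ‖z j‖ - ‖z j‖| + |‖z j‖ - ‖z₀ j‖| := abs_sub_le _ _ _
      _ ≤ ρ := by linarith [hz j]
  have hbound := norm_laurentCoeff_mul_laurentMonomial_le (g := g) hw0 (M := M)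
    (fun θ => hM _ fun j => by rw [norm_torusRotate_apply]; exact hwshell j) α
  rw [ha w ⟨hsub hwshell, hw0⟩] at hbound
  have hmono : laurentMonomial α w = (∏ j, l ^ (α j).natAbs : ℝ) * laurentMonomial α z := by
    simp only [laurentMonomial, hw, mul_zpow, Finset.prod_mul_distrib, ← hsz]
    push_cast
    rfl
  have hP : 0 < ∏ j, l ^ (α j).natAbs := Finset.prod_pos fun j _ => pow_pos hl0 _
  rw [hmono, mul_left_comm, norm_mul, Complex.norm_real, Real.norm_eq_abs, abs_of_pos hP] at hbound
  simp_rw [inv_pow, Finset.prod_inv_distrib]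
  rw [← div_eq_mul_inv, le_div_iff₀ hP, mul_comm]
  exact hbound

/-- If `α j < 0` and `a α ≠ 0`, the term blows up as the `j`-th coordinate tends to `0`, against the
local bound near a point of `U` with `z j = 0`. -/
lemma laurentTermsDefinedOn (hU : IsConnectedReinhardtDomain U)
    {g : (Fin n → ℂ) → ℂ} (hg : DifferentiableOn ℂ g U) {a : (Fin n → ℤ) → ℂ}
    (ha : ∀ w ∈ U ∩ nonzeroCoords n, ∀ α, laurentCoeff g w α = a α) :
    LaurentTermsDefinedOn U a := by
  intro α haα z hz j hj hzj
  obtain ⟨N, hNU, hN, hzN, M, q, hq0, hq1, hb⟩ := hU.exists_local_bound_nonzeroCoords hg ha hz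
  -- The choice of `v` allows its `j`-th coordinate to tend to `0` inside `N` while the other
  -- coordinates stay fixed and nonzero.
  obtain ⟨v, hvN, hv0⟩ : ∃ v, (v ∈ N ∧ Function.update v j 0 ∈ N) ∧ v ∈ nonzeroCoords n := by
    have hO : IsOpen (N ∩ (fun v => Function.update v j (0 : ℂ)) ⁻¹' N) :=
      hN.inter (hN.preimage (continuous_id.update j continuous_const))
    have hz' : Function.update z j 0 = z := by rw [← hzj, Function.update_eq_self]
    obtain ⟨v, hv, hv0⟩ := dense_nonzeroCoords.inter_open_nonempty _ hO
      ⟨z, hzN, by simpa [hz'] using hzN⟩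
    exact ⟨v, hv, hv0⟩
  have hu : Continuous fun t : ℂ => Function.update v j t :=
    continuous_const.update j continuous_id
  have hev : ∀ᶠ t in 𝓝[≠] (0 : ℂ), Function.update v j t ∈ N ∩ nonzeroCoords n := by
    have h1 : ∀ᶠ t in 𝓝 (0 : ℂ), Function.update v j t ∈ N :=
      hu.continuousAt.eventually (hN.mem_nhds hvN.2)
    filter_upwards [mem_nhdsWithin_of_mem_nhds h1, self_mem_nhdsWithin] with t ht ht0
    refine ⟨ht, fun i => ?_⟩
    by_cases hi : i = j
    · subst hi; simpa using ht0
    · simpa [hi] using hv0 i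
  set C : ℝ := ∏ i ∈ Finset.univ.erase j, ‖v i ^ α i‖ with hC
  have hCpos : 0 < C := Finset.prod_pos fun i _ => norm_pos_iff.2 (zpow_ne_zero _ (hv0 i))
  have hnorm : ∀ t : ℂ, ‖laurentMonomial α (Function.update v j t)‖ = ‖t ^ α j‖ * C := by
    intro t
    rw [laurentMonomial, norm_prod, ← Finset.mul_prod_erase _ _ (Finset.mem_univ j), hC]
    congr 1
    · simp
    · refine Finset.prod_congr rfl fun i hi => ?_
      rw [Function.update_of_ne (Finset.ne_of_mem_erase hi)]
  have ht : Tendsto (fun t : ℂ => ‖a α‖ * (‖t ^ α j‖ * C)) (𝓝[≠] 0) atTop :=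
    ((tendsto_norm_cobounded_atTop.comp
      (tendsto_zpow_nhdsNE_zero_cobounded hj)).atTop_mul_const hCpos).const_mul_atTop
      (norm_pos_iff.2 haα)
  obtain ⟨t, ht1, ht2⟩ := (hev.and (ht.eventually_gt_atTop
    (M * ∏ j, q ^ (α j).natAbs))).exists
  have := hb _ ht1 α
  rw [norm_mul, hnorm] at this
  exact absurd this (not_le.2 ht2)

end IsConnectedReinhardtDomain

lemma LaurentTermsDefinedOn.continuousOn {a : (Fin n → ℤ) → ℂ} (ha : LaurentTermsDefinedOn U a)
    (α : Fin n → ℤ) : ContinuousOn (fun z => a α * laurentMonomial α z) U := by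
  rcases eq_or_ne (a α) 0 with h0 | h0
  · simpa [h0] using continuousOn_const
  · intro z hz
    refine ContinuousAt.continuousWithinAt ?_
    refine continuousAt_const.mul (continuousAt_laurentMonomial α fun j => ?_)
    rcases lt_or_ge (α j) 0 with h | h
    · exact Or.inl (ha α h0 z hz j h)
    · exact Or.inr h

lemma mem_closure_inter_nonzeroCoords {N : Set (Fin n → ℂ)} (hN : IsOpen N) :
    N ⊆ closure (N ∩ nonzeroCoords n) :=
  dense_nonzeroCoords.open_subset_closure_inter hN

namespace IsConnectedReinhardtDomain

/-- The terms are now known to be continuous on `U`, so the estimate passes to the hyperplanes by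
density. -/
lemma exists_local_bound (hU : IsConnectedReinhardtDomain U)
    {g : (Fin n → ℂ) → ℂ} (hg : DifferentiableOn ℂ g U) {a : (Fin n → ℤ) → ℂ}
    (ha : ∀ w ∈ U ∩ nonzeroCoords n, ∀ α, laurentCoeff g w α = a α) {z₀ : Fin n → ℂ}
    (hz₀ : z₀ ∈ U) :
    ∃ N ⊆ U, IsOpen N ∧ z₀ ∈ N ∧ ∃ u : (Fin n → ℤ) → ℝ, Summable u ∧
      ∀ z ∈ N, ∀ α, ‖a α * laurentMonomial α z‖ ≤ u α := by
  obtain ⟨N, hNU, hN, hzN, M, q, hq0, hq1, hb⟩ := hU.exists_local_bound_nonzeroCoords hg ha hz₀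
  refine ⟨N, hNU, hN, hzN, _, (summable_prod_pow_natAbs hq0.le hq1).mul_left M, fun z hz α => ?_⟩
  have hc : ContinuousWithinAt (fun z => ‖a α * laurentMonomial α z‖) (N ∩ nonzeroCoords n) z :=
    (((hU.laurentTermsDefinedOn hg ha).continuousOn α).norm z (hNU hz)).mono
      (inter_subset_left.trans hNU)
  have : (𝓝[N ∩ nonzeroCoords n] z).NeBot :=
    mem_closure_iff_nhdsWithin_neBot.1 (mem_closure_inter_nonzeroCoords hN hz)
  refine le_of_tendsto hc ?_
  filter_upwards [self_mem_nhdsWithin] with y hy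
  exact hb y hy α

lemma hasLaurentExpansionOn (hU : IsConnectedReinhardtDomain U)
    {g : (Fin n → ℂ) → ℂ} (hg : DifferentiableOn ℂ g U) {a : (Fin n → ℤ) → ℂ}
    (ha : ∀ w ∈ U ∩ nonzeroCoords n, ∀ α, laurentCoeff g w α = a α) :
    HasLaurentExpansionOn U a g := by
  refine ⟨hU.laurentTermsDefinedOn hg ha, fun z hz => ?_⟩
  obtain ⟨N, hNU, hN, hzN, u, hu, hb⟩ := hU.exists_local_bound hg ha hz
  have hsum : ∀ y ∈ N, Summable fun α => a α * laurentMonomial α y := fun y hy =>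
    Summable.of_norm_bounded hu (hb y hy)
  have hS : ContinuousOn (fun y => ∑' α, a α * laurentMonomial α y) N :=
    continuousOn_tsum (fun α => ((hU.laurentTermsDefinedOn hg ha).continuousOn α).mono hNU) hu
      fun α y hy => hb y hy α
  have heq : EqOn (fun y => ∑' α, a α * laurentMonomial α y) g (N ∩ nonzeroCoords n) := by
    intro w hw
    have hwU : w ∈ U ∩ nonzeroCoords n := ⟨hNU hw.1, hw.2⟩
    have hcont : Continuous fun θ => g (torusRotate w θ) :=
      hg.continuousOn.comp_continuous (continuous_torusRotate w)
        fun θ => hU.torusRotate_mem hwU.1 θ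
    have := hasSum_laurentCoeff_of_summable hw.2 hcont
      (by simpa only [ha w hwU] using hsum w hw.1)
    simp only [ha w hwU] at this
    exact this.tsum_eq
  have hfull : EqOn (fun y => ∑' α, a α * laurentMonomial α y) g N :=
    heq.of_subset_closure hS (hg.continuousOn.mono hNU) inter_subset_left
      (mem_closure_inter_nonzeroCoords hN)
  have := (hsum z hzN).hasSum
  rwa [show ∑' α, a α * laurentMonomial α z = g z from hfull hzN] at this

lemma exists_summable_bound (hU : IsConnectedReinhardtDomain U)
    {g : (Fin n → ℂ) → ℂ} (hg : DifferentiableOn ℂ g U) {a : (Fin n → ℤ) → ℂ}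
    (ha : ∀ w ∈ U ∩ nonzeroCoords n, ∀ α, laurentCoeff g w α = a α) {K : Set (Fin n → ℂ)}
    (hKU : K ⊆ U) (hK : IsCompact K) :
    ∃ u : (Fin n → ℤ) → ℝ, Summable u ∧ ∀ z ∈ K, ∀ α, ‖a α * laurentMonomial α z‖ ≤ u α := by
  set p : Set (Fin n → ℂ) → Prop := fun K => ∃ u : (Fin n → ℤ) → ℝ, Summable u ∧
    ∀ z ∈ K, ∀ α, ‖a α * laurentMonomial α z‖ ≤ u α with hp
  have h0 : p ∅ := ⟨fun _ => 0, summable_zero, fun z hz => absurd hz (notMem_empty z)⟩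
  have h1 : ∀ ⦃s t⦄, s ⊆ t → p t → p s := by
    rintro s t hst ⟨u, hu, hb⟩
    exact ⟨u, hu, fun z hz => hb z (hst hz)⟩
  have h2 : ∀ ⦃s t⦄, p s → p t → p (s ∪ t) := by
    rintro s t ⟨u, hu, hb⟩ ⟨v, hv, hb'⟩
    -- Absolute values are needed because, over an empty set, nothing forces `u` or `v` to be
    -- nonnegative.
    refine ⟨fun α => |u α| + |v α|, hu.abs.add hv.abs, ?_⟩
    rintro z (hz | hz) α
    · exact (hb z hz α).trans ((le_abs_self _).trans (le_add_of_nonneg_right (abs_nonneg _)))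
    · exact (hb' z hz α).trans ((le_abs_self _).trans (le_add_of_nonneg_left (abs_nonneg _)))
  have h3 : ∀ z ∈ K, ∃ t ∈ 𝓝[K] z, p t := by
    intro z hz
    obtain ⟨N, -, hN, hzN, u, hu, hb⟩ := hU.exists_local_bound hg ha (hKU hz)
    exact ⟨N, mem_nhdsWithin_of_mem_nhds (hN.mem_nhds hzN), u, hu, hb⟩
  exact hK.induction_on h0 h1 h2 h3

lemma laurentConvergesNormallyOn (hU : IsConnectedReinhardtDomain U)
    {g : (Fin n → ℂ) → ℂ} (hg : DifferentiableOn ℂ g U) {a : (Fin n → ℤ) → ℂ}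
    (ha : ∀ w ∈ U ∩ nonzeroCoords n, ∀ α, laurentCoeff g w α = a α) :
    LaurentConvergesNormallyOn U a := by
  refine ⟨hU.laurentTermsDefinedOn hg ha, fun K hKU hK ε hε => ?_⟩
  obtain ⟨u, hu, hb⟩ := hU.exists_summable_bound hg ha hKU hK
  obtain ⟨Λ, hΛ⟩ := ((tendsto_order.1 (tendsto_tsum_compl_atTop_zero u)).2 ε hε).exists
  refine ⟨Λ, fun z hz => ?_⟩
  have hu' : Summable fun α : {α // α ∉ Λ} => u α.1 := hu.subtype _
  have hs : Summable fun α : {α // α ∉ Λ} => ‖a α.1 * laurentMonomial α.1 z‖ :=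
    Summable.of_nonneg_of_le (fun α => norm_nonneg _) (fun α => hb z hz α.1) hu'
  have h1 := Summable.tsum_le_tsum (fun α : {α // α ∉ Λ} => hb z hz α.1) hs hu'
  exact ⟨hs, lt_of_le_of_lt h1 hΛ⟩

lemma eq_of_hasLaurentExpansionOn (hU : IsConnectedReinhardtDomain U)
    {g : (Fin n → ℂ) → ℂ} {w : Fin n → ℂ} (hw : w ∈ U ∩ nonzeroCoords n)
    {c : (Fin n → ℤ) → ℂ} (hc : HasLaurentExpansionOn U c g) : c = laurentCoeff g w :=
  funext fun β => (laurentCoeff_eq_of_hasSum hw.2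
    (fun θ => hc.2 _ (hU.torusRotate_mem hw.1 θ)) β).symm

end IsConnectedReinhardtDomain

end Expansion

/-! ### Partial sums as rational functions without poles -/

section RationalApproximation

variable {n : ℕ} {U : Set (Fin n → ℂ)}

/-- The multi-indices with all entries between `-k` and `k`. -/
noncomputable def indexBox (n k : ℕ) : Finset (Fin n → ℤ) :=
  Fintype.piFinset fun _ => Finset.Icc (-(k : ℤ)) k

lemma mem_indexBox {k : ℕ} {α : Fin n → ℤ} :
    α ∈ indexBox n k ↔ ∀ j, -(k : ℤ) ≤ α j ∧ α j ≤ k := by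
  simp [indexBox]

lemma eventually_subset_indexBox (Λ : Finset (Fin n → ℤ)) :
    ∀ᶠ k in atTop, Λ ⊆ indexBox n k := by
  have h : ∀ α ∈ Λ, ∀ᶠ k : ℕ in atTop, α ∈ indexBox n k := by
    intro α _
    simp only [mem_indexBox]
    refine eventually_all.2 fun j => ?_
    filter_upwards [eventually_ge_atTop (α j).natAbs] with k hk
    omega
  exact (Finset.eventually_all Λ).2 h

open scoped Classical in
/-- The power by which the `j`-th variable is multiplied to clear denominators on `U`. -/
noncomputable def clearingExponent (U : Set (Fin n → ℂ)) (k : ℕ) (j : Fin n) : ℕ :=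
  if ∀ z ∈ U, z j ≠ 0 then k else 0

/-- The common denominator of the Laurent monomials with exponents in `indexBox n k`. -/
noncomputable def clearingDenominator (U : Set (Fin n → ℂ)) (k : ℕ) : MvPolynomial (Fin n) ℂ :=
  ∏ j, MvPolynomial.X j ^ clearingExponent U k j

/-- The numerator of the `k`-th partial sum of a Laurent series. -/
noncomputable def clearedNumerator (U : Set (Fin n → ℂ)) (k : ℕ) (a : (Fin n → ℤ) → ℂ) :
    MvPolynomial (Fin n) ℂ :=
  ∑ α ∈ indexBox n k,
    MvPolynomial.C (a α) * ∏ j, MvPolynomial.X j ^ (α j + clearingExponent U k j).toNat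

lemma eval_clearingDenominator_ne_zero (k : ℕ) {z : Fin n → ℂ} (hz : z ∈ U) :
    MvPolynomial.eval z (clearingDenominator U k) ≠ 0 := by
  simp only [clearingDenominator, map_prod, map_pow, MvPolynomial.eval_X]
  refine Finset.prod_ne_zero_iff.2 fun j _ => ?_
  unfold clearingExponent
  split_ifs with h
  · exact pow_ne_zero _ (h z hz)
  · simp

lemma LaurentTermsDefinedOn.eval_clearedNumerator_div {a : (Fin n → ℤ) → ℂ}
    (ha : LaurentTermsDefinedOn U a) (k : ℕ) {z : Fin n → ℂ} (hz : z ∈ U) :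
    MvPolynomial.eval z (clearedNumerator U k a) /
      MvPolynomial.eval z (clearingDenominator U k) =
      ∑ α ∈ indexBox n k, a α * laurentMonomial α z := by
  rw [div_eq_iff (eval_clearingDenominator_ne_zero k hz), Finset.sum_mul]
  simp only [clearedNumerator, clearingDenominator, map_sum, map_mul, map_prod, map_pow,
    MvPolynomial.eval_X, MvPolynomial.eval_C]
  refine Finset.sum_congr rfl fun α hα => ?_
  rcases eq_or_ne (a α) 0 with h0 | h0
  · simp [h0]
  rw [mul_assoc, laurentMonomial, ← Finset.prod_mul_distrib]
  congr 1
  refine Finset.prod_congr rfl fun j _ => ?_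
  unfold clearingExponent
  split_ifs with h
  · have h1 := (mem_indexBox.1 hα j).1
    rw [← zpow_natCast, ← zpow_natCast, Int.toNat_of_nonneg (by omega), zpow_add₀ (h z hz)]
  -- Here `U` meets the hyperplane `z j = 0`, so no power is cleared, and a nonzero coefficient
  -- forces `α j ≥ 0`.
  · push Not at h
    obtain ⟨y, hy, hyj⟩ := h
    have h1 : 0 ≤ α j := by
      by_contra hneg
      exact ha α h0 y hy j (not_le.1 hneg) hyj
    rw [← zpow_natCast, Int.toNat_of_nonneg (by simpa using h1)]
    simp

lemma LaurentConvergesNormallyOn.tendstoUniformlyOn {a : (Fin n → ℤ) → ℂ}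
    {g : (Fin n → ℂ) → ℂ} (ha : LaurentConvergesNormallyOn U a)
    (hg : HasLaurentExpansionOn U a g) {K : Set (Fin n → ℂ)} (hKU : K ⊆ U) (hK : IsCompact K) :
    TendstoUniformlyOn (fun k z => ∑ α ∈ indexBox n k, a α * laurentMonomial α z) g atTop K := by
  rw [Metric.tendstoUniformlyOn_iff]
  intro ε hε
  obtain ⟨Λ, hΛ⟩ := ha.2 K hKU hK ε hε
  filter_upwards [eventually_subset_indexBox Λ] with k hk z hz
  obtain ⟨hs, hlt⟩ := hΛ z hz
  have hsum := hg.2 z (hKU hz)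
  have hnorm : Summable fun α => ‖a α * laurentMonomial α z‖ := hsum.summable.norm
  have h1 := hsum.summable.sum_add_tsum_compl (s := indexBox n k)
  have h2 := hnorm.sum_add_tsum_compl (s := indexBox n k)
  have h3 := hnorm.sum_add_tsum_compl (s := Λ)
  -- Once the box contains `Λ`, its tail of norms is at most the tail outside `Λ`.
  have h4 : ∑ α ∈ Λ, ‖a α * laurentMonomial α z‖ ≤
      ∑ α ∈ indexBox n k, ‖a α * laurentMonomial α z‖ :=
    Finset.sum_le_sum_of_subset_of_nonneg hk fun _ _ _ => norm_nonneg _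
  rw [hsum.tsum_eq] at h1
  rw [dist_eq_norm, ← h1, add_sub_cancel_left]
  calc _ ≤ ∑' α : ↑((indexBox n k : Set (Fin n → ℤ))ᶜ), ‖a α.1 * laurentMonomial α.1 z‖ :=
        norm_tsum_le_tsum_norm (hnorm.subtype _)
    _ ≤ ∑' α : ↑((Λ : Set (Fin n → ℤ))ᶜ), ‖a α.1 * laurentMonomial α.1 z‖ := by linarith
    _ < ε := hlt

end RationalApproximation

theorem mainTheorem9 {Ω : Type*} [MeasurableSpace Ω] {n : ℕ}
    (U : Set (Fin n → ℂ)) (hU : IsConnectedReinhardtDomain U)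
    (f : Ω → (Fin n → ℂ) → ℂ) (hf : IsRandomHolomorphicOn U f) :
    (∃ a : Ω → (Fin n → ℤ) → ℂ,
      IsRandomLaurentSeries a ∧
      (∀ ω, HasLaurentExpansionOn U (a ω) (f ω)) ∧
      (∀ ω, LaurentConvergesNormallyOn U (a ω)) ∧
      (∀ ω, ∀ c : (Fin n → ℤ) → ℂ, HasLaurentExpansionOn U c (f ω) → c = a ω)) ∧
    (∃ r : ℕ → Ω → (Fin n → ℂ) → ℂ,
      (∀ k, IsRandomRationalOn U (r k)) ∧
      ∀ ω, ∀ K ⊆ U, IsCompact K →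
        TendstoUniformlyOn (fun k => r k ω) (f ω) Filter.atTop K) := by
  obtain ⟨w, hw⟩ : (U ∩ nonzeroCoords n).Nonempty :=
    dense_nonzeroCoords.inter_open_nonempty U hU.isOpen hU.isConnected.nonempty
  have hcoeff : ∀ ω, ∀ v ∈ U ∩ nonzeroCoords n, ∀ α,
      laurentCoeff (f ω) v α = laurentCoeff (f ω) w α :=
    fun ω v hv α => hU.laurentCoeff_eq (hf.holomorphic ω) hv hw α
  have hmeas : IsRandomLaurentSeries fun ω => laurentCoeff (f ω) w := fun α =>
    measurable_laurentCoeff (fun θ => hf.measurable _ (hU.torusRotate_mem hw.1 θ))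
      (fun ω => (hf.holomorphic ω).continuousOn.comp_continuous (continuous_torusRotate w)
        fun θ => hU.torusRotate_mem hw.1 θ) α
  have hexp : ∀ ω, HasLaurentExpansionOn U (laurentCoeff (f ω) w) (f ω) := fun ω =>
    hU.hasLaurentExpansionOn (hf.holomorphic ω) (hcoeff ω)
  have hnormal : ∀ ω, LaurentConvergesNormallyOn U (laurentCoeff (f ω) w) := fun ω =>
    hU.laurentConvergesNormallyOn (hf.holomorphic ω) (hcoeff ω)
  refine ⟨⟨fun ω => laurentCoeff (f ω) w, hmeas, hexp, hnormal,
    fun ω c hc => hU.eq_of_hasLaurentExpansionOn hw hc⟩,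
    fun k ω z => ∑ α ∈ indexBox n k, laurentCoeff (f ω) w α * laurentMonomial α z,
    fun k => ⟨fun ω => clearedNumerator U k (laurentCoeff (f ω) w),
      fun _ => clearingDenominator U k, fun z => ?_, fun z => measurable_const,
      fun ω z hz => ⟨eval_clearingDenominator_ne_zero k hz,
        ((hexp ω).1.eval_clearedNumerator_div k hz).symm⟩⟩,
    fun ω K hKU hK => (hnormal ω).tendstoUniformlyOn (hexp ω) hKU hK⟩
  simp only [clearedNumerator, map_sum, map_mul, MvPolynomial.eval_C]
  exact Finset.measurable_sum _ fun α _ => (hmeas α).mul_const _
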